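/- Let $n\ge 2$ be an integer and $\hbar=2/\sqrt{n^2-1}$. Let $S_1,S_2,S_3$ be the Hermitian spin matrices of the irreducible $n$-dimensional (spin $\tfrac{n-1}{2}$) representation in the standard weight basis, so that $[S_1,S_2]=\mathrm i S_3$ and cyclically and $S_3=\operatorname{diag}\bigl(\tfrac{n-1}2,\tfrac{n-3}2,\dots,-\tfrac{n-1}2\bigr)$, and put $X_\alpha=-\mathrm i\hbar S_\alpha\in\mathfrak{su}(n)$ for $\alpha=1,2,3$; thus $[X_1,X_2]=\hbar X_3$ and cyclically. Let $$\Delta_nP=\frac1{\hbar^2}\sum_{\alpha=1}^3[X_\alpha,[X_\alpha,P]]$$ be the Hoppe–Yau Laplacian on the space $\mathfrak{su}(n)$ of traceless skew-Hermitian matrices. A rotation $R\in\mathrm{SO}(3)$ acts on $W\in\mathfrak{su}(n)$ by $$R\cdot W=F_RWF_R^\dagger,\qquad F_R=\exp\Bigl(\frac1\hbar\sum_{\alpha=1}^3\rho_\alpha X_\alpha\Bigr),$$ where $\rho=(\rho_1,\rho_2,\rho_3)$, $|\rho|\le\pi$, are the components of a logarithm $\log R\in\mathfrak{so}(3)\simeq\mathbb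 R^3$ in the canonical basis (so that $R$ is the exponential of $v\mapsto\rho\times v$). Let $W_0,P_0\in\mathfrak{su}(n)$ be a steady state of Zeitlin's model on the sphere, that is, $[P_0,W_0]=0$ and $W_0=\Delta_nP_0$. Let $\Lambda\in\mathrm U(n)$ be a common eigenbasis, with $\Lambda^\dagger P_0\Lambda=\operatorname{diag}(\mathrm ip_1,\dots,\mathrm ip_n)$ and $\Lambda^\dagger W_0\Lambda=\operatorname{diag}(\mathrm iw_1,\dots,\mathrm iw_n)$, where $p_j,w_j\in\mathbb R$. Assume that $$\frac{w_{j+m}-w_j}{p_{j+m}-p_j}>-6$$ for all $m\in\{1,\dots,n-1\}$ and $j\in\{1,\dots,n-m\}$ with $p_{j+m}\ne p_j$. Then there exists $R\in\mathrm{SO}(3)$ such that $R\cdot W_0$ is a diagonal matrix. -/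

import Mathlib

open scoped Matrix

namespace Zeitlin

/-- The real Lie algebra of traceless skew-Hermitian `n × n` matrices. -/
def su (n : ℕ) : Set (Matrix (Fin n) (Fin n) ℂ) := {A | Aᴴ = -A ∧ A.trace = 0}

/-- The parameter `2 / √(n² - 1)` (used only for `n ≥ 2`). -/
noncomputable def hbar (n : ℕ) : ℝ := 2 / Real.sqrt ((n : ℝ) ^ 2 - 1)

/-- The raising operator of the `n`-dimensional (spin `(n - 1) / 2`) irreducible representation,
in the weight basis ordered by decreasing weight. -/
noncomputable def spinPlus (n : ℕ) : Matrix (Fin n) (Fin n) ℂ :=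
  Matrix.of fun j k =>
    if (k : ℕ) = (j : ℕ) + 1 then ((Real.sqrt ((k : ℝ) * ((n : ℝ) - (k : ℝ))) : ℝ) : ℂ) else 0

/-- The Hermitian spin matrices `S₁, S₂, S₃`, with `[S₁, S₂] = i S₃` and cyclically;
`S₃` is diagonal with entries `(n - 1) / 2, (n - 3) / 2, …, -(n - 1) / 2`. -/
noncomputable def spin (n : ℕ) : Fin 3 → Matrix (Fin n) (Fin n) ℂ :=
  ![(1 / 2 : ℂ) • (spinPlus n + (spinPlus n)ᴴ),
    (1 / (2 * Complex.I) : ℂ) • (spinPlus n - (spinPlus n)ᴴ),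
    Matrix.diagonal fun k => ((n : ℂ) - 1) / 2 - (k : ℂ)]

/-- The skew-Hermitian generators `X₁, X₂, X₃`, normalised by `[X₁, X₂] = ħ X₃` (and cyclically),
equivalently `X₁² + X₂² + X₃² = -1`. -/
noncomputable def X (n : ℕ) (α : Fin 3) : Matrix (Fin n) (Fin n) ℂ :=
  (-Complex.I * (hbar n : ℂ)) • spin n α

/-- The matrix commutator. -/
def comm {n : ℕ} (A B : Matrix (Fin n) (Fin n) ℂ) : Matrix (Fin n) (Fin n) ℂ := A * B - B * A

/-- The Hoppe–Yau Laplacian `Δₙ P = ħ⁻² ∑ α, [X α, [X α, P]]`. -/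
noncomputable def laplacian (n : ℕ) (P : Matrix (Fin n) (Fin n) ℂ) : Matrix (Fin n) (Fin n) ℂ :=
  (1 / (hbar n : ℂ) ^ 2) • ∑ α, comm (X n α) (comm (X n α) P)

/-- `W, P` is a steady state of Zeitlin's model: `W, P ∈ 𝔰𝔲(n)`, `[P, W] = 0`, `W = Δₙ P`. -/
structure IsSteadyState (n : ℕ) (W P : Matrix (Fin n) (Fin n) ℂ) : Prop where
  vorticity_mem : W ∈ su n
  stream_mem : P ∈ su n
  comm_eq_zero : comm P W = 0
  laplacian_eq : W = laplacian n P

/-- The element of `𝔰𝔬(3)` with components `ρ` in the canonical basis, i.e. the matrix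
of the linear map `v ↦ ρ × v`. -/
def so3OfVec (ρ : Fin 3 → ℝ) : Matrix (Fin 3) (Fin 3) ℝ :=
  !![0, -ρ 2, ρ 1;
     ρ 2, 0, -ρ 0;
     -ρ 1, ρ 0, 0]

open Classical in
/-- The components of a principal logarithm of a rotation `R`: a vector `ρ` of Euclidean length at
most `π` (rotation axis times rotation angle) with `exp (so3OfVec ρ) = R`. Every rotation has one;
it is unique unless the angle is `π`, when `ρ` and `-ρ` both qualify and lead to the same action. -/
noncomputable def rotLog (R : Matrix.specialOrthogonalGroup (Fin 3) ℝ) : Fin 3 → ℝ :=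
  if h : ∃ ρ : Fin 3 → ℝ, ∑ α, ρ α ^ 2 ≤ Real.pi ^ 2 ∧
      NormedSpace.exp (so3OfVec ρ) = (R : Matrix (Fin 3) (Fin 3) ℝ)
  then h.choose else 0

/-- The unitary matrix `F_R = exp (ħ⁻¹ ∑ α, ρ α • X α)` with `ρ = log R`. The matrices `ħ⁻¹ X α`
satisfy the commutation relations of the canonical basis of `𝔰𝔬(3)`, so that this is the spin
representation. -/
noncomputable def rotUnitary (n : ℕ) (R : Matrix.specialOrthogonalGroup (Fin 3) ℝ) :
    Matrix (Fin n) (Fin n) ℂ :=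
  NormedSpace.exp ((1 / (hbar n : ℂ)) • ∑ α, (rotLog R α : ℂ) • X n α)

/-- The action `R · W = F_R W F_R†` of rotations on matrices. -/
noncomputable def rotate (n : ℕ) (R : Matrix.specialOrthogonalGroup (Fin 3) ℝ)
    (W : Matrix (Fin n) (Fin n) ℂ) : Matrix (Fin n) (Fin n) ℂ :=
  rotUnitary n R * W * (rotUnitary n R)ᴴ

end Zeitlin

/-!
The proof combines a symmetry argument with the spectral gap of the Hoppe–Yau Laplacian.

The adjoint action of the spin matrices commutes with `Δₙ`, whose negative is the Casimir operator
`casimirOp n`. A highest weight vector of weight `m` has Casimir eigenvalue `m (m + 1)`, and those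
of weight `0` and `1` are the multiples of `1` and of the raising operator. Hence the Casimir operator
is at least `6` on the orthogonal complement `highModes n` of `1` and the spin matrices
(`six_mul_le_trace_casimirOp`).

Let `P`, `W` be the steady state and let `v ≠ 0` be an axis parallel to the degree-one part of `P`.
With `S_v = ∑ v_α S_α`, the infinitesimal rotation `B = [S_v, P]` has no components of degree `0` or
`1` (`exists_axis`), so `⟨Δₙ B, B⟩ ≤ -6 |B|²`. On the other hand `Δₙ B = [S_v, W]`, and in the common
eigenbasis of `P` and `W` the entries of `[S_v, W]` and `[S_v, P]` have the ratios
`(w_k - w_j) / (p_k - p_j) > -6`. Both can hold only if `B = 0` (`lie_eq_zero_of_gap`), and then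
`[S_v, W] = Δₙ B = 0` as well.

A rotation taking `v` to the third axis turns `S_v` into a nonzero multiple of `S₃`, by the
equivariance `rotate_spinVec`. The rotated `W` commutes with `S₃`, which is diagonal with distinct
entries, so it is diagonal (`exists_rotate_isDiag`).
-/

attribute [local instance] LieRing.ofAssociativeRing

namespace Zeitlin

/-! ### The Casimir element of an `𝔰𝔩₂`-triple in an associative ring -/

section Casimir

variable {A : Type*} [Ring A] {e f h : A}

/-- The Casimir element `f e + h² + h`, for `e, f, h` with `[e, f] = 2 h`, `[h, e] = e`
and `[h, f] = -f`. This `h` is half of the usual one, so that it acts by the weights of `S₃`; on a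
vector of weight `m` killed by `e` the Casimir element is `m (m + 1)`. -/
def casimir (e f h : A) : A := f * e + h * h + h

lemma casimir_comm_h (he : h * e - e * h = e) (hf : h * f - f * h = -f) :
    Commute (casimir e f h) h := by
  have he' : h * e = e * h + e := by rw [← sub_eq_iff_eq_add']; exact he
  have hf' : h * f = f * h - f := by rw [sub_eq_iff_eq_add'.mp hf]; abel
  have : h * (f * e) = f * e * h := by
    rw [← mul_assoc, hf', sub_mul, mul_assoc, he', mul_add]; noncomm_ring
  unfold casimir Commute SemiconjBy
  rw [mul_add, mul_add, this]; noncomm_ring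

lemma casimir_comm_e (hef : e * f - f * e = 2 * h) (he : h * e - e * h = e) :
    Commute (casimir e f h) e := by
  have he' : h * e = e * h + e := by rw [← sub_eq_iff_eq_add']; exact he
  have hef' : e * f = f * e + 2 * h := by rw [← sub_eq_iff_eq_add']; exact hef
  have h1 : e * (f * e) = f * e * e + 2 * (e * h + e) := by
    rw [← mul_assoc, hef', add_mul, mul_assoc 2, he']
  have h2 : h * h * e = e * h * h + 2 * (e * h) + e := by
    rw [mul_assoc, he', mul_add, ← mul_assoc, he']; noncomm_ring
  unfold casimir Commute SemiconjBy
  rw [add_mul, add_mul, h2, he', mul_add, mul_add, h1]; noncomm_ring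

lemma casimir_comm_f (hef : e * f - f * e = 2 * h) (hf : h * f - f * h = -f) :
    Commute (casimir e f h) f := by
  have hf' : h * f = f * h - f := by rw [sub_eq_iff_eq_add'.mp hf]; abel
  have hef' : e * f = f * e + 2 * h := by rw [← sub_eq_iff_eq_add']; exact hef
  have h1 : f * e * f = f * (f * e) + 2 * (f * h) := by
    rw [mul_assoc, hef']; noncomm_ring
  have h2 : h * h * f = f * h * h - 2 * (f * h) + f := by
    rw [mul_assoc, hf', mul_sub, ← mul_assoc, hf']; noncomm_ring
  unfold casimir Commute SemiconjBy
  rw [add_mul, add_mul, h1, h2, hf']; noncomm_ring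

end Casimir

/-! ### The spin matrices -/

/-- The entry of the raising operator in column `k`, counted from `0`; it vanishes for `k = 0` and
`k = n`. -/
noncomputable def rung (n k : ℕ) : ℂ := ((Real.sqrt ((k : ℝ) * ((n : ℝ) - (k : ℝ))) : ℝ) : ℂ)

lemma rung_sq {n k : ℕ} (hk : k ≤ n) : rung n k * rung n k = k * (n - k) := by
  have : (0 : ℝ) ≤ (k : ℝ) * ((n : ℝ) - k) :=
    mul_nonneg (by positivity) (sub_nonneg.2 (by exact_mod_cast hk))
  rw [rung, ← Complex.ofReal_mul, Real.mul_self_sqrt this]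
  push_cast; rfl

lemma rung_ne_zero {n k : ℕ} (h0 : 0 < k) (hk : k < n) : rung n k ≠ 0 := by
  have : (0 : ℝ) < (k : ℝ) * ((n : ℝ) - k) :=
    mul_pos (by exact_mod_cast h0) (sub_pos.2 (by exact_mod_cast hk))
  rw [rung, Complex.ofReal_ne_zero]
  exact (Real.sqrt_pos.2 this).ne'

@[simp] lemma star_rung (n k : ℕ) : star (rung n k) = rung n k := by simp [rung]

lemma spinPlus_apply (n : ℕ) (j k : Fin n) :
    spinPlus n j k = if (k : ℕ) = (j : ℕ) + 1 then rung n k else 0 := rfl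

/-- The `k`-th diagonal entry of `S₃`, counted from `0`. -/
noncomputable def weight (n : ℕ) (k : Fin n) : ℂ := ((n : ℂ) - 1) / 2 - (k : ℂ)

lemma spin_two (n : ℕ) : spin n 2 = Matrix.diagonal (weight n) := rfl

lemma spin_zero (n : ℕ) : spin n 0 = (1 / 2 : ℂ) • (spinPlus n + (spinPlus n)ᴴ) := rfl

lemma spin_one (n : ℕ) :
    spin n 1 = (1 / (2 * Complex.I) : ℂ) • (spinPlus n - (spinPlus n)ᴴ) := rfl

lemma spinPlus_mul_apply {n : ℕ} (T : Matrix (Fin n) (Fin n) ℂ) (j k : Fin n) :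
    (spinPlus n * T) j k =
      if h : (j : ℕ) + 1 < n then rung n (j + 1) * T ⟨j + 1, h⟩ k else 0 := by
  rw [Matrix.mul_apply]
  split_ifs with h
  · rw [Finset.sum_eq_single ⟨j + 1, h⟩]
    · simp [spinPlus_apply]
    · intro b _ hb
      rw [spinPlus_apply, if_neg (fun h' => hb (Fin.ext h')), zero_mul]
    · simp
  · refine Finset.sum_eq_zero fun b _ => ?_
    rw [spinPlus_apply, if_neg (by omega), zero_mul]

lemma mul_spinPlus_apply {n : ℕ} (T : Matrix (Fin n) (Fin n) ℂ) (j k : Fin n) :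
    (T * spinPlus n) j k =
      if h : 0 < (k : ℕ) then T j ⟨k - 1, by omega⟩ * rung n k else 0 := by
  rw [Matrix.mul_apply]
  split_ifs with h
  · rw [Finset.sum_eq_single ⟨k - 1, by omega⟩]
    · rw [spinPlus_apply, if_pos (by simp only; omega)]
    · intro b _ hb
      rw [spinPlus_apply, if_neg, mul_zero]
      intro h'; exact hb (Fin.ext (by simp only; omega))
    · simp
  · refine Finset.sum_eq_zero fun b _ => ?_
    rw [spinPlus_apply, if_neg (by omega), mul_zero]

lemma conjTranspose_spinPlus_apply (n : ℕ) (j k : Fin n) :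
    (spinPlus n)ᴴ j k = if (j : ℕ) = (k : ℕ) + 1 then rung n j else 0 := by
  rw [Matrix.conjTranspose_apply, spinPlus_apply]
  split_ifs <;> simp

lemma lie_spinPlus_spinMinus (n : ℕ) : ⁅spinPlus n, (spinPlus n)ᴴ⁆ = (2 : ℂ) • spin n 2 := by
  ext j k
  have hj := j.isLt
  rw [Ring.lie_def, Matrix.sub_apply, spinPlus_mul_apply, mul_spinPlus_apply, spin_two,
    Matrix.smul_apply, Matrix.diagonal_apply]
  simp only [conjTranspose_spinPlus_apply]
  by_cases hjk : j = k
  · subst hjk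
    have h1 : (if h : (j : ℕ) + 1 < n then
        rung n (j + 1) * (if (j : ℕ) + 1 = j + 1 then rung n (j + 1) else 0) else 0)
        = ((j : ℂ) + 1) * (n - (j + 1)) := by
      split_ifs with h
      · rw [rung_sq h.le]; push_cast; ring
      · omega
      · have : (n : ℂ) = j + 1 := by exact_mod_cast (by omega : n = j + 1)
        rw [this]; ring
    have h2 : (if h : 0 < (j : ℕ) then
        (if (j : ℕ) = j - 1 + 1 then rung n j else 0) * rung n j else 0)
        = (j : ℂ) * (n - j) := by
      split_ifs with h h'
      · rw [rung_sq hj.le]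
      · omega
      · have : (j : ℕ) = 0 := by omega
        rw [this]; simp
    rw [h1, h2, if_pos rfl, weight, smul_eq_mul]
    ring
  · have hjk' : (j : ℕ) ≠ k := fun h => hjk (Fin.ext h)
    rw [if_neg hjk]
    split_ifs <;> first | omega | simp

lemma lie_spin_two_apply {n : ℕ} (T : Matrix (Fin n) (Fin n) ℂ) (j k : Fin n) :
    ⁅spin n 2, T⁆ j k = ((k : ℂ) - (j : ℂ)) * T j k := by
  rw [Ring.lie_def, spin_two, Matrix.sub_apply, Matrix.diagonal_mul, Matrix.mul_diagonal, weight,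
    weight]
  ring

lemma lie_spin_two_spinPlus (n : ℕ) : ⁅spin n 2, spinPlus n⁆ = spinPlus n := by
  ext j k
  rw [lie_spin_two_apply, spinPlus_apply]
  split_ifs with h
  · rw [h]; push_cast; ring
  · simp

lemma lie_spin_two_spinMinus (n : ℕ) : ⁅spin n 2, (spinPlus n)ᴴ⁆ = -(spinPlus n)ᴴ := by
  ext j k
  rw [lie_spin_two_apply, Matrix.neg_apply, conjTranspose_spinPlus_apply]
  split_ifs with h
  · rw [h]; push_cast; ring
  · simp

lemma conjTranspose_spin_two (n : ℕ) : (spin n 2)ᴴ = spin n 2 := by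
  rw [spin_two, Matrix.diagonal_conjTranspose]
  congr 1
  ext k
  simp [weight]

/-! ### The adjoint action and the Hoppe–Yau Laplacian -/

/-- The adjoint operator `T ↦ [A, T]` on matrices. -/
noncomputable abbrev adM {n : ℕ} (A : Matrix (Fin n) (Fin n) ℂ) :
    Module.End ℂ (Matrix (Fin n) (Fin n) ℂ) :=
  LieAlgebra.ad ℂ (Matrix (Fin n) (Fin n) ℂ) A

lemma adM_mul_sub {n : ℕ} (A B : Matrix (Fin n) (Fin n) ℂ) :
    adM A * adM B - adM B * adM A = adM ⁅A, B⁆ :=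
  (LieHom.map_lie (LieAlgebra.ad ℂ (Matrix (Fin n) (Fin n) ℂ)) A B).symm

/-- The Casimir operator of the adjoint action of the spin matrices. It is positive semidefinite,
the negative of the Hoppe–Yau Laplacian. -/
noncomputable def casimirOp (n : ℕ) : Module.End ℂ (Matrix (Fin n) (Fin n) ℂ) :=
  casimir (adM (spinPlus n)) (adM (spinPlus n)ᴴ) (adM (spin n 2))

lemma adM_spin_two_spinPlus (n : ℕ) :
    adM (spin n 2) * adM (spinPlus n) - adM (spinPlus n) * adM (spin n 2) = adM (spinPlus n) := by
  rw [adM_mul_sub, lie_spin_two_spinPlus]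

lemma adM_spin_two_spinMinus (n : ℕ) :
    adM (spin n 2) * adM (spinPlus n)ᴴ - adM (spinPlus n)ᴴ * adM (spin n 2)
      = -adM (spinPlus n)ᴴ := by
  rw [adM_mul_sub, lie_spin_two_spinMinus, adM, map_neg]

lemma adM_spinPlus_spinMinus (n : ℕ) :
    adM (spinPlus n) * adM (spinPlus n)ᴴ - adM (spinPlus n)ᴴ * adM (spinPlus n)
      = 2 * adM (spin n 2) := by
  rw [adM_mul_sub, lie_spinPlus_spinMinus, adM, map_smul, two_smul, two_mul]

lemma casimirOp_comm_spin_two (n : ℕ) : Commute (casimirOp n) (adM (spin n 2)) :=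
  casimir_comm_h (adM_spin_two_spinPlus n) (adM_spin_two_spinMinus n)

lemma casimirOp_comm_spinPlus (n : ℕ) : Commute (casimirOp n) (adM (spinPlus n)) :=
  casimir_comm_e (adM_spinPlus_spinMinus n) (adM_spin_two_spinPlus n)

lemma casimirOp_comm_spinMinus (n : ℕ) : Commute (casimirOp n) (adM (spinPlus n)ᴴ) :=
  casimir_comm_f (adM_spinPlus_spinMinus n) (adM_spin_two_spinMinus n)

lemma casimirOp_comm_spin (n : ℕ) (α : Fin 3) : Commute (casimirOp n) (adM (spin n α)) := by
  fin_cases α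
  · change Commute _ (adM (spin n 0))
    rw [spin_zero, adM, map_smul, map_add]
    exact ((casimirOp_comm_spinPlus n).add_right (casimirOp_comm_spinMinus n)).smul_right _
  · change Commute _ (adM (spin n 1))
    rw [spin_one, adM, map_smul, map_sub]
    exact ((casimirOp_comm_spinPlus n).sub_right (casimirOp_comm_spinMinus n)).smul_right _
  · exact casimirOp_comm_spin_two n

lemma casimirOp_eq_sum (n : ℕ) :
    casimirOp n = ∑ α, adM (spin n α) * adM (spin n α) := by
  have h := adM_spinPlus_spinMinus n
  have h1 : (1 / (2 * Complex.I) * (1 / (2 * Complex.I)) : ℂ) = -(1 / 4) := by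
    field_simp; rw [Complex.I_sq]; norm_num
  rw [Fin.sum_univ_three, spin_zero, spin_one]
  simp only [adM, map_smul, map_add, map_sub, smul_mul_smul_comm, h1]
  rw [casimirOp, casimir]
  have h2 : adM (spinPlus n) * adM (spinPlus n)ᴴ
      = adM (spinPlus n)ᴴ * adM (spinPlus n) + (2 : ℂ) • adM (spin n 2) := by
    rw [← sub_eq_iff_eq_add', h, two_smul, two_mul]
  simp only [adM] at h2 ⊢
  simp only [add_mul, mul_add, sub_mul, mul_sub, h2]
  module

lemma hbar_ne_zero {n : ℕ} (hn : 2 ≤ n) : (hbar n : ℂ) ≠ 0 := by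
  have : (0 : ℝ) < (n : ℝ) ^ 2 - 1 := by
    have : (2 : ℝ) ≤ n := by exact_mod_cast hn
    nlinarith
  rw [hbar, Complex.ofReal_ne_zero]
  exact div_ne_zero two_ne_zero (Real.sqrt_pos.2 this).ne'

lemma laplacian_eq_neg_casimirOp {n : ℕ} (hn : 2 ≤ n) (P : Matrix (Fin n) (Fin n) ℂ) :
    laplacian n P = -casimirOp n P := by
  have h0 := hbar_ne_zero hn
  have key : ∀ α, comm (X n α) (comm (X n α) P)
      = (-(hbar n : ℂ) ^ 2) • adM (spin n α) (adM (spin n α) P) := by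
    intro α
    change ⁅X n α, ⁅X n α, P⁆⁆ = _ • ⁅spin n α, ⁅spin n α, P⁆⁆
    rw [X, smul_lie, smul_lie, lie_smul, smul_smul]
    congr 1
    linear_combination ((hbar n : ℂ) ^ 2) * Complex.I_sq
  rw [laplacian, casimirOp_eq_sum, LinearMap.sum_apply]
  simp only [key, Module.End.mul_apply]
  have h1 : 1 / (hbar n : ℂ) ^ 2 * -(hbar n : ℂ) ^ 2 = -1 := by field_simp
  rw [← Finset.smul_sum, smul_smul, h1, neg_smul, one_smul]

/-! ### Commutation relations of the spin matrices -/

lemma lie_spin_zero_one (n : ℕ) : ⁅spin n 0, spin n 1⁆ = Complex.I • spin n 2 := by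
  have h := lie_spinPlus_spinMinus n
  have h' : ⁅(spinPlus n)ᴴ, spinPlus n⁆ = -((2 : ℂ) • spin n 2) := by rw [← lie_skew, h]
  rw [spin_zero, spin_one, smul_lie, lie_smul, add_lie, lie_sub, lie_sub, lie_self, lie_self, h, h',
    smul_smul]
  match_scalars
  field_simp
  rw [Complex.I_sq]; norm_num

lemma lie_spin_one_two (n : ℕ) : ⁅spin n 1, spin n 2⁆ = Complex.I • spin n 0 := by
  rw [← lie_skew, spin_one, spin_zero, lie_smul, lie_sub, lie_spin_two_spinPlus,
    lie_spin_two_spinMinus, ← smul_neg]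
  match_scalars <;> field_simp <;> rw [Complex.I_sq]

lemma lie_spin_two_zero (n : ℕ) : ⁅spin n 2, spin n 0⁆ = Complex.I • spin n 1 := by
  rw [spin_one, spin_zero, lie_smul, lie_add, lie_spin_two_spinPlus, lie_spin_two_spinMinus]
  match_scalars <;> field_simp

lemma conjTranspose_spin (n : ℕ) (α : Fin 3) : (spin n α)ᴴ = spin n α := by
  fin_cases α
  · change (spin n 0)ᴴ = spin n 0
    rw [spin_zero, Matrix.conjTranspose_smul, Matrix.conjTranspose_add,
      Matrix.conjTranspose_conjTranspose, add_comm]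
    simp
  · change (spin n 1)ᴴ = spin n 1
    rw [spin_one, Matrix.conjTranspose_smul, Matrix.conjTranspose_sub,
      Matrix.conjTranspose_conjTranspose]
    have : star (1 / (2 * Complex.I)) = -(1 / (2 * Complex.I)) := by simp
    rw [this]
    module
  · exact conjTranspose_spin_two n

/-! ### The spectral gap of the Casimir operator -/

/-- The orthogonal complement of the span of `1` and the spin matrices, that is, of the matrix
harmonics of degree at most one. The ladder matrices are used in place of `S₁` and `S₂`, which have
the same span. -/
def highModes (n : ℕ) : Submodule ℂ (Matrix (Fin n) (Fin n) ℂ) where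
  carrier := {T | T.trace = 0 ∧ (spinPlus n * T).trace = 0 ∧ ((spinPlus n)ᴴ * T).trace = 0 ∧
    (spin n 2 * T).trace = 0}
  add_mem' := by
    rintro A B ⟨h1, h2, h3, h4⟩ ⟨k1, k2, k3, k4⟩
    simp [mul_add, Matrix.trace_add, *]
  zero_mem' := by simp
  smul_mem' := by
    rintro c A ⟨h1, h2, h3, h4⟩
    simp [Matrix.trace_smul, *]

lemma trace_mul_lie {n : ℕ} (A B T : Matrix (Fin n) (Fin n) ℂ) :
    (A * ⁅B, T⁆).trace = (⁅A, B⁆ * T).trace := by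
  rw [Ring.lie_def, Ring.lie_def, mul_sub, sub_mul, Matrix.trace_sub, Matrix.trace_sub,
    ← mul_assoc, ← mul_assoc, Matrix.trace_mul_cycle A T B]

lemma trace_lie {n : ℕ} (B T : Matrix (Fin n) (Fin n) ℂ) : (⁅B, T⁆).trace = 0 := by
  rw [Ring.lie_def, Matrix.trace_sub, Matrix.trace_mul_comm, sub_self]

lemma lie_spinPlus_mem {n : ℕ} {T : Matrix (Fin n) (Fin n) ℂ} (hT : T ∈ highModes n) :
    ⁅spinPlus n, T⁆ ∈ highModes n := by
  obtain ⟨-, h2, h3, h4⟩ := hT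
  refine ⟨trace_lie _ _, ?_, ?_, ?_⟩
  · rw [trace_mul_lie, lie_self, zero_mul, Matrix.trace_zero]
  · rw [trace_mul_lie, ← lie_skew, lie_spinPlus_spinMinus, neg_mul, smul_mul_assoc,
      Matrix.trace_neg, Matrix.trace_smul, h4, smul_zero, neg_zero]
  · rw [trace_mul_lie, lie_spin_two_spinPlus, h2]

lemma lie_spinMinus_mem {n : ℕ} {T : Matrix (Fin n) (Fin n) ℂ} (hT : T ∈ highModes n) :
    ⁅(spinPlus n)ᴴ, T⁆ ∈ highModes n := by
  obtain ⟨-, h2, h3, h4⟩ := hT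
  refine ⟨trace_lie _ _, ?_, ?_, ?_⟩
  · rw [trace_mul_lie, lie_spinPlus_spinMinus, smul_mul_assoc, Matrix.trace_smul, h4, smul_zero]
  · rw [trace_mul_lie, lie_self, zero_mul, Matrix.trace_zero]
  · rw [trace_mul_lie, lie_spin_two_spinMinus, neg_mul, Matrix.trace_neg, h3, neg_zero]

lemma lie_spin_two_mem {n : ℕ} {T : Matrix (Fin n) (Fin n) ℂ} (hT : T ∈ highModes n) :
    ⁅spin n 2, T⁆ ∈ highModes n := by
  obtain ⟨-, h2, h3, h4⟩ := hT
  refine ⟨trace_lie _ _, ?_, ?_, ?_⟩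
  · rw [trace_mul_lie, ← lie_skew, lie_spin_two_spinPlus, neg_mul, Matrix.trace_neg, h2, neg_zero]
  · rw [trace_mul_lie, ← lie_skew, lie_spin_two_spinMinus, neg_neg, h3]
  · rw [trace_mul_lie, lie_self, zero_mul, Matrix.trace_zero]

lemma casimirOp_apply {n : ℕ} (T : Matrix (Fin n) (Fin n) ℂ) :
    casimirOp n T = ⁅(spinPlus n)ᴴ, ⁅spinPlus n, T⁆⁆ + ⁅spin n 2, ⁅spin n 2, T⁆⁆ + ⁅spin n 2, T⁆ :=
  rfl

lemma casimirOp_mem {n : ℕ} {T : Matrix (Fin n) (Fin n) ℂ} (hT : T ∈ highModes n) :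
    casimirOp n T ∈ highModes n := by
  rw [casimirOp_apply]
  exact add_mem (add_mem (lie_spinMinus_mem (lie_spinPlus_mem hT))
    (lie_spin_two_mem (lie_spin_two_mem hT))) (lie_spin_two_mem hT)

lemma lie_spinPlus_apply {n : ℕ} (T : Matrix (Fin n) (Fin n) ℂ) (j k : Fin n) :
    ⁅spinPlus n, T⁆ j k =
      (if h : (j : ℕ) + 1 < n then rung n (j + 1) * T ⟨j + 1, h⟩ k else 0) -
      (if h : 0 < (k : ℕ) then T j ⟨k - 1, by omega⟩ * rung n k else 0) := by
  rw [Ring.lie_def, Matrix.sub_apply, spinPlus_mul_apply, mul_spinPlus_apply]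

/-- Raising moves every entry one diagonal up, so the raising operator is nilpotent. -/
lemma adM_spinPlus_pow_eq_zero (n : ℕ) : (adM (spinPlus n)) ^ (2 * n) = 0 := by
  have key : ∀ (T : Matrix (Fin n) (Fin n) ℂ) (i : ℕ) (j k : Fin n), (k : ℕ) + n < j + i →
      ((adM (spinPlus n)) ^ i) T j k = 0 := by
    intro T i
    induction i with
    | zero => intro j k h; omega
    | succ i ih =>
      intro j k h
      rw [pow_succ', Module.End.mul_apply, LieAlgebra.ad_apply, lie_spinPlus_apply]
      have h1 : ∀ h' : (j : ℕ) + 1 < n,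
          ((adM (spinPlus n)) ^ i) T ⟨j + 1, h'⟩ k = 0 := fun h' =>
        ih _ _ (by simp only; omega)
      have h2 : ∀ h' : 0 < (k : ℕ),
          ((adM (spinPlus n)) ^ i) T j ⟨k - 1, by omega⟩ = 0 := fun h' =>
        ih _ _ (by simp only; omega)
      split_ifs with h3 h4 h4 <;> simp [*]
  refine LinearMap.ext fun T => ?_
  ext j k
  rw [key T _ j k (by omega)]
  rfl

/-- The highest weight vectors are the matrices commuting with `spinPlus n`. They are determined by
their first row, and those supported on the first two diagonals are combinations of `1` and
`spinPlus n`. -/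
lemma eq_of_lie_spinPlus_eq_zero {n : ℕ} (hn : 2 ≤ n) {T : Matrix (Fin n) (Fin n) ℂ}
    (hT : ⁅spinPlus n, T⁆ = 0) (hup : ∀ j k : Fin n, (j : ℕ) + 2 ≤ k → T j k = 0) :
    ∃ c d : ℂ, T = c • 1 + d • spinPlus n := by
  have hent : ∀ j k : Fin n, ∀ h : (j : ℕ) + 1 < n,
      rung n (j + 1) * T ⟨j + 1, h⟩ k =
        if h : 0 < (k : ℕ) then T j ⟨k - 1, by omega⟩ * rung n k else 0 := by
    intro j k h
    have := congrFun (congrFun hT j) k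
    rwa [lie_spinPlus_apply, dif_pos h, Matrix.zero_apply, sub_eq_zero] at this
  have hlow : ∀ (j : ℕ) (hj : j < n) (k : Fin n), (k : ℕ) < j → T ⟨j, hj⟩ k = 0 := by
    intro j
    induction j with
    | zero => intro _ _ h; omega
    | succ j ih =>
      intro hj k hk
      have h := hent ⟨j, by omega⟩ k hj
      have : (if h : 0 < (k : ℕ) then T ⟨j, by omega⟩ ⟨k - 1, by omega⟩ * rung n k else 0) = 0 := by
        split_ifs with h'
        · rw [ih _ _ (by simp only; omega), zero_mul]
        · rfl
      rw [this] at h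
      exact (mul_eq_zero.1 h).resolve_left (rung_ne_zero (by omega) hj)
  have hdiag : ∀ (j : ℕ) (hj : j < n), T ⟨j, hj⟩ ⟨j, hj⟩ = T ⟨0, by omega⟩ ⟨0, by omega⟩ := by
    intro j
    induction j with
    | zero => intro _; rfl
    | succ j ih =>
      intro hj
      have h := hent ⟨j, by omega⟩ ⟨j + 1, hj⟩ hj
      rw [dif_pos (by simp)] at h
      simp only [Nat.add_sub_cancel] at h
      rw [ih (by omega), mul_comm] at h
      exact mul_right_cancel₀ (rung_ne_zero (by omega) hj) h
  have hsup : ∀ (j : ℕ) (hj : j + 1 < n), T ⟨j, by omega⟩ ⟨j + 1, hj⟩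
      = T ⟨0, by omega⟩ ⟨1, by omega⟩ / rung n 1 * rung n (j + 1) := by
    intro j
    induction j with
    | zero =>
      intro hj
      exact (div_mul_cancel₀ _ (rung_ne_zero (by omega) (by omega))).symm
    | succ j ih =>
      intro hj
      have h := hent ⟨j, by omega⟩ ⟨j + 1 + 1, hj⟩ (by simp only; omega)
      rw [dif_pos (by simp)] at h
      simp only [Nat.add_sub_cancel] at h
      rw [ih (by omega)] at h
      refine mul_left_cancel₀ (rung_ne_zero (n := n) (k := j + 1) (by omega) (by omega)) ?_
      rw [h]; ring
  refine ⟨T ⟨0, by omega⟩ ⟨0, by omega⟩, T ⟨0, by omega⟩ ⟨1, by omega⟩ / rung n 1, ?_⟩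
  ext ⟨j, hj⟩ ⟨k, hk⟩
  rw [Matrix.add_apply, Matrix.smul_apply, Matrix.smul_apply, spinPlus_apply, Matrix.one_apply]
  simp only [Fin.mk.injEq, smul_eq_mul]
  rcases lt_trichotomy j k with h | h | h
  · rw [if_neg (by omega)]
    by_cases h1 : k = j + 1
    · subst h1
      rw [if_pos rfl, hsup j hk]; simp
    · rw [if_neg h1, hup _ _ (by simp only; omega)]; simp
  · subst h
    rw [hdiag j hj]; simp
  · rw [hlow j hj _ h, if_neg (by omega), if_neg (by omega)]; simp

open scoped ComplexOrder in
lemma trace_spinMinus_mul_spinPlus_ne_zero {n : ℕ} (hn : 2 ≤ n) :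
    ((spinPlus n)ᴴ * spinPlus n).trace ≠ 0 := by
  intro h
  rw [Matrix.trace_conjTranspose_mul_self_eq_zero_iff] at h
  have := congrFun (congrFun h ⟨0, by omega⟩) ⟨1, by omega⟩
  rw [spinPlus_apply, if_pos rfl] at this
  exact rung_ne_zero one_pos (by omega) this

/-- A highest weight vector of weight `m` has Casimir eigenvalue `m (m + 1)`, and the ones with
`m ≤ 1` are excluded by `highModes`. -/
lemma six_le_of_highest_weight {n : ℕ} (hn : 2 ≤ n) {T : Matrix (Fin n) (Fin n) ℂ}
    (hT : T ∈ highModes n) (h0 : T ≠ 0) (hlie : ⁅spinPlus n, T⁆ = 0) {c : ℝ}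
    (hc : casimirOp n T = (c : ℂ) • T) : 6 ≤ c := by
  by_contra! hlt
  -- On the diagonal `k - j = m` the Casimir operator acts by `m (m + 1)`, which for `m ≥ 2` is at
  -- least `6`: only the first two diagonals survive.
  have hent : ∀ j k : Fin n,
      (((k : ℂ) - j) * ((k : ℂ) - j) + ((k : ℂ) - j)) * T j k = c * T j k := by
    intro j k
    have := congrFun (congrFun hc j) k
    rw [casimirOp_apply, hlie, lie_zero, zero_add, Matrix.add_apply, lie_spin_two_apply,
      lie_spin_two_apply, Matrix.smul_apply, smul_eq_mul] at this
    rw [← this]; ring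
  have hup : ∀ j k : Fin n, (j : ℕ) + 2 ≤ k → T j k = 0 := by
    intro j k hjk
    by_contra hne
    have h := mul_right_cancel₀ hne (hent j k)
    have h' : ((k : ℝ) - j) * ((k : ℝ) - j) + ((k : ℝ) - j) = c := by exact_mod_cast h
    have : (j : ℝ) + 2 ≤ k := by exact_mod_cast hjk
    nlinarith
  obtain ⟨a, d, rfl⟩ := eq_of_lie_spinPlus_eq_zero hn hlie hup
  obtain ⟨h1, -, h3, -⟩ := hT
  have tp : (spinPlus n).trace = 0 := by
    rw [← lie_spin_two_spinPlus, trace_lie]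
  have ha : a = 0 := by
    rw [Matrix.trace_add, Matrix.trace_smul, Matrix.trace_smul, tp, Matrix.trace_one] at h1
    simpa [show n ≠ 0 by omega] using h1
  rw [ha, zero_smul, zero_add, mul_smul_comm, Matrix.trace_smul, smul_eq_mul] at h3
  have hd := (mul_eq_zero.1 h3).resolve_right (trace_spinMinus_mul_spinPlus_ne_zero hn)
  exact h0 (by simp [ha, hd])

/-- Raising an eigenvector until it would vanish produces a highest weight vector with the same
Casimir eigenvalue. -/
lemma six_le_of_eigenvector {n : ℕ} (hn : 2 ≤ n) {T : Matrix (Fin n) (Fin n) ℂ}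
    (hT : T ∈ highModes n) (h0 : T ≠ 0) {c : ℝ}
    (hc : casimirOp n T = (c : ℂ) • T) : 6 ≤ c := by
  classical
  have hex : ∃ i, ((adM (spinPlus n)) ^ i) T = 0 :=
    ⟨2 * n, by rw [adM_spinPlus_pow_eq_zero]; rfl⟩
  obtain ⟨i, hi⟩ : ∃ i, Nat.find hex = i + 1 := by
    refine Nat.exists_eq_succ_of_ne_zero fun h => h0 ?_
    have := Nat.find_spec hex
    rwa [h] at this
  have hne : ((adM (spinPlus n)) ^ i) T ≠ 0 := Nat.find_min hex (by omega)
  have hz : ((adM (spinPlus n)) ^ (i + 1)) T = 0 := hi ▸ Nat.find_spec hex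
  have hmem : ∀ i, ((adM (spinPlus n)) ^ i) T ∈ highModes n := by
    intro i
    induction i with
    | zero => exact hT
    | succ i ih => rw [pow_succ', Module.End.mul_apply]; exact lie_spinPlus_mem ih
  refine six_le_of_highest_weight hn (hmem i) hne ?_ (c := c) ?_
  · rwa [pow_succ', Module.End.mul_apply] at hz
  · rw [← Module.End.mul_apply, ((casimirOp_comm_spinPlus n).pow_right i).eq, Module.End.mul_apply,
      hc, map_smul]

open scoped InnerProductSpace in
/-- A symmetric operator whose eigenvectors in an invariant subspace all have eigenvalue at least
`c` is bounded below by `c` on this subspace. -/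
lemma le_re_inner_of_forall_eigenvector {E : Type*} [NormedAddCommGroup E] [InnerProductSpace ℂ E]
    [FiniteDimensional ℂ E] {C : E →ₗ[ℂ] E} (hC : C.IsSymmetric) {V : Submodule ℂ E}
    (hV : ∀ x ∈ V, C x ∈ V) {c : ℝ}
    (heig : ∀ x ∈ V, x ≠ 0 → ∀ μ : ℝ, C x = (μ : ℂ) • x → c ≤ μ) {x : E} (hx : x ∈ V) :
    c * (⟪x, x⟫_ℂ).re ≤ (⟪x, C x⟫_ℂ).re := by
  have hS : (C.restrict hV).IsSymmetric := hC.restrict_invariant hV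
  let b := hS.eigenvectorBasis rfl
  have hb : ∀ i, c ≤ hS.eigenvalues rfl i := by
    intro i
    have h := hS.hasEigenvector_eigenvectorBasis rfl i
    refine heig _ (b i).2 (fun h' => h.2 (Subtype.ext h')) _ ?_
    exact congrArg Subtype.val h.apply_eq_smul
  let y : V := ⟨x, hx⟩
  have h1 : (⟪x, x⟫_ℂ).re = ∑ i, ‖⟪b i, y⟫_ℂ‖ ^ 2 := by
    have : ⟪x, x⟫_ℂ = ⟪y, y⟫_ℂ := rfl
    rw [this, ← b.sum_inner_mul_inner y y, Complex.re_sum]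
    refine Finset.sum_congr rfl fun i _ => ?_
    rw [← inner_conj_symm, Complex.conj_mul', ← Complex.ofReal_pow, Complex.ofReal_re]
  have h2 : (⟪x, C x⟫_ℂ).re = ∑ i, hS.eigenvalues rfl i * ‖⟪b i, y⟫_ℂ‖ ^ 2 := by
    have : ⟪x, C x⟫_ℂ = ⟪y, C.restrict hV y⟫_ℂ := rfl
    rw [this, ← b.sum_inner_mul_inner y, Complex.re_sum]
    refine Finset.sum_congr rfl fun i _ => ?_
    rw [← hS (b i) y, hS.apply_eigenvectorBasis rfl i, inner_smul_left, ← inner_conj_symm,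
      mul_left_comm, Complex.conj_mul', ← Complex.ofReal_pow, RCLike.ofReal_eq_complex_ofReal,
      Complex.conj_ofReal, ← Complex.ofReal_mul, Complex.ofReal_re]
  rw [h1, h2, Finset.mul_sum]
  exact Finset.sum_le_sum fun i _ => mul_le_mul_of_nonneg_right (hb i) (sq_nonneg _)

lemma trace_conjTranspose_mul_lie {n : ℕ} {S : Matrix (Fin n) (Fin n) ℂ} (hS : Sᴴ = S)
    (A B : Matrix (Fin n) (Fin n) ℂ) : (⁅S, A⁆ᴴ * B).trace = (Aᴴ * ⁅S, B⁆).trace := by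
  rw [trace_mul_lie, Ring.lie_def, Ring.lie_def, Matrix.conjTranspose_sub,
    Matrix.conjTranspose_mul, Matrix.conjTranspose_mul, hS]

lemma trace_conjTranspose_mul_casimirOp {n : ℕ} (A B : Matrix (Fin n) (Fin n) ℂ) :
    ((casimirOp n A)ᴴ * B).trace = (Aᴴ * casimirOp n B).trace := by
  rw [casimirOp_eq_sum, LinearMap.sum_apply, LinearMap.sum_apply, Matrix.conjTranspose_sum,
    Finset.sum_mul, Finset.mul_sum, Matrix.trace_sum, Matrix.trace_sum]
  refine Finset.sum_congr rfl fun α _ => ?_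
  simp only [Module.End.mul_apply, LieAlgebra.ad_apply]
  rw [trace_conjTranspose_mul_lie (conjTranspose_spin n α),
    trace_conjTranspose_mul_lie (conjTranspose_spin n α)]

open scoped ComplexOrder in
/-- The spectral gap: `casimirOp n ≥ 6` on matrices without modes of degree `0` and `1`. -/
lemma six_mul_le_trace_casimirOp {n : ℕ} (hn : 2 ≤ n) {T : Matrix (Fin n) (Fin n) ℂ}
    (hT : T ∈ highModes n) :
    6 * ((Tᴴ * T).trace).re ≤ ((Tᴴ * casimirOp n T).trace).re := by
  let : NormedAddCommGroup (Matrix (Fin n) (Fin n) ℂ) :=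
    Matrix.toMatrixNormedAddCommGroup 1 Matrix.PosDef.one
  let : InnerProductSpace ℂ (Matrix (Fin n) (Fin n) ℂ) :=
    Matrix.toMatrixInnerProductSpace 1 Matrix.PosSemidef.one
  have hinner : ∀ A B : Matrix (Fin n) (Fin n) ℂ, inner ℂ A B = (Aᴴ * B).trace := by
    intro A B
    change (B * 1 * Aᴴ).trace = _
    rw [mul_one, Matrix.trace_mul_comm]
  have hC : (casimirOp n).IsSymmetric := by
    intro A B
    rw [hinner, hinner, trace_conjTranspose_mul_casimirOp]
  have := le_re_inner_of_forall_eigenvector hC (fun x => casimirOp_mem)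
    (fun x hx h0 μ hμ => six_le_of_eigenvector hn hx h0 hμ) hT
  rwa [hinner, hinner] at this

/-! ### Steady states with a gap commute with a spin matrix -/

/-- The spin matrix in direction `v`. -/
noncomputable def spinVec (n : ℕ) (v : Fin 3 → ℝ) : Matrix (Fin n) (Fin n) ℂ :=
  ∑ α, (v α : ℂ) • spin n α

lemma spinVec_eq (n : ℕ) (v : Fin 3 → ℝ) :
    spinVec n v = (v 0 : ℂ) • spin n 0 + (v 1 : ℂ) • spin n 1 + (v 2 : ℂ) • spin n 2 := by
  rw [spinVec, Fin.sum_univ_three]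

lemma mem_highModes {n : ℕ} {T : Matrix (Fin n) (Fin n) ℂ} (h0 : T.trace = 0)
    (h : ∀ α, (spin n α * T).trace = 0) : T ∈ highModes n := by
  have h1 : spinPlus n = spin n 0 + Complex.I • spin n 1 := by
    rw [spin_zero, spin_one]
    match_scalars <;> field_simp <;> norm_num
  have h2 : (spinPlus n)ᴴ = spin n 0 - Complex.I • spin n 1 := by
    rw [spin_zero, spin_one]
    match_scalars <;> field_simp <;> norm_num
  refine ⟨h0, ?_, ?_, h 2⟩
  · rw [h1, add_mul, Matrix.trace_add, smul_mul_assoc, Matrix.trace_smul, h, h]; simp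
  · rw [h2, sub_mul, Matrix.trace_sub, smul_mul_assoc, Matrix.trace_smul, h, h]; simp

/-- Rotating about the axis given by the degree-one part of `P` does not create a degree-one
component. -/
lemma exists_axis {n : ℕ} {P : Matrix (Fin n) (Fin n) ℂ} (hP : Pᴴ = -P) :
    ∃ v : Fin 3 → ℝ, v ≠ 0 ∧ ⁅spinVec n v, P⁆ ∈ highModes n := by
  set t : Fin 3 → ℝ := fun α => ((spin n α * P).trace).im with ht
  have htr : ∀ α, (spin n α * P).trace = (t α : ℂ) * Complex.I := by
    intro α
    have h1 : star ((spin n α * P).trace) = -(spin n α * P).trace := by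
      rw [← Matrix.trace_conjTranspose, Matrix.conjTranspose_mul, hP, conjTranspose_spin,
        neg_mul, Matrix.trace_neg, Matrix.trace_mul_comm]
    have h2 : ((spin n α * P).trace).re = 0 := by
      have := congrArg Complex.re h1
      simp only [Complex.star_def, Complex.conj_re, Complex.neg_re] at this
      linarith
    apply Complex.ext <;> simp [h2, ht]
  -- `i t` is the degree-one part of `P`; any axis will do if it vanishes.
  obtain ⟨v, hv, hvt⟩ : ∃ v : Fin 3 → ℝ, v ≠ 0 ∧ ∀ α β, v α * t β = v β * t α := by
    by_cases h : t = 0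
    · exact ⟨1, one_ne_zero, by simp [h]⟩
    · exact ⟨t, h, fun α β => mul_comm _ _⟩
  have hvt' : ∀ α β, (v α : ℂ) * t β = v β * t α := fun α β => by exact_mod_cast hvt α β
  have h01 := lie_spin_zero_one n
  have h12 := lie_spin_one_two n
  have h20 := lie_spin_two_zero n
  have h10 : ⁅spin n 1, spin n 0⁆ = -(Complex.I • spin n 2) := by rw [← lie_skew, h01]
  have h21 : ⁅spin n 2, spin n 1⁆ = -(Complex.I • spin n 0) := by rw [← lie_skew, h12]
  have h02 : ⁅spin n 0, spin n 2⁆ = -(Complex.I • spin n 1) := by rw [← lie_skew, h20]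
  refine ⟨v, hv, mem_highModes (trace_lie _ _) fun α => ?_⟩
  rw [trace_mul_lie, spinVec_eq]
  fin_cases α
  · change (⁅spin n 0, _⁆ * P).trace = 0
    simp only [lie_add, lie_smul, lie_self, h01, h02, add_mul, smul_mul_assoc, neg_mul,
      Matrix.trace_add, Matrix.trace_smul, Matrix.trace_neg, htr, smul_eq_mul, zero_mul,
      Matrix.trace_zero]
    linear_combination Complex.I ^ 2 * hvt' 1 2
  · change (⁅spin n 1, _⁆ * P).trace = 0
    simp only [lie_add, lie_smul, lie_self, h10, h12, add_mul, smul_mul_assoc, neg_mul,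
      Matrix.trace_add, Matrix.trace_smul, Matrix.trace_neg, htr, smul_eq_mul, zero_mul,
      Matrix.trace_zero]
    linear_combination Complex.I ^ 2 * hvt' 2 0
  · change (⁅spin n 2, _⁆ * P).trace = 0
    simp only [lie_add, lie_smul, lie_self, h20, h21, add_mul, smul_mul_assoc, neg_mul,
      Matrix.trace_add, Matrix.trace_smul, Matrix.trace_neg, htr, smul_eq_mul, zero_mul,
      Matrix.trace_zero]
    linear_combination Complex.I ^ 2 * hvt' 0 1

lemma trace_conjTranspose_mul {n : ℕ} (A B : Matrix (Fin n) (Fin n) ℂ) :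
    (Aᴴ * B).trace = ∑ j, ∑ k, star (A j k) * B j k := by
  rw [Finset.sum_comm]
  simp [Matrix.trace, Matrix.mul_apply]

lemma lie_diagonal_apply {n : ℕ} (Y : Matrix (Fin n) (Fin n) ℂ) (d : Fin n → ℝ) (j k : Fin n) :
    ⁅Y, Matrix.diagonal fun j => Complex.I * (d j : ℂ)⁆ j k
      = Complex.I * ((d k - d j : ℝ) : ℂ) * Y j k := by
  rw [Ring.lie_def, Matrix.sub_apply, Matrix.mul_diagonal, Matrix.diagonal_mul]
  push_cast
  ring

lemma lie_conj {n : ℕ} {Λ : Matrix (Fin n) (Fin n) ℂ} (hΛ : Λ * Λᴴ = 1)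
    (S A : Matrix (Fin n) (Fin n) ℂ) : Λᴴ * ⁅S, A⁆ * Λ = ⁅Λᴴ * S * Λ, Λᴴ * A * Λ⁆ := by
  have h : ∀ A B : Matrix (Fin n) (Fin n) ℂ,
      Λᴴ * A * Λ * (Λᴴ * B * Λ) = Λᴴ * (A * B) * Λ := by
    intro A B
    calc _ = Λᴴ * A * (Λ * Λᴴ) * B * Λ := by simp only [mul_assoc]
      _ = _ := by rw [hΛ, mul_one, mul_assoc Λᴴ A B]
  rw [Ring.lie_def, Ring.lie_def, h, h, mul_sub, sub_mul]

lemma trace_conj {n : ℕ} {Λ : Matrix (Fin n) (Fin n) ℂ} (hΛ : Λ * Λᴴ = 1)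
    (A B : Matrix (Fin n) (Fin n) ℂ) :
    ((Λᴴ * A * Λ)ᴴ * (Λᴴ * B * Λ)).trace = (Aᴴ * B).trace := by
  calc _ = (Λᴴ * (Aᴴ * (Λ * Λᴴ) * B) * Λ).trace := by
        simp only [Matrix.conjTranspose_mul, Matrix.conjTranspose_conjTranspose, mul_assoc]
    _ = _ := by rw [hΛ, mul_one, Matrix.trace_mul_comm, ← mul_assoc, hΛ, one_mul]

/-- In a common eigenbasis `⟨[S, P], [S, W]⟩` is the sum of `|S j k|² (p k - p j) (w k - w j)`, so
that the bound on the difference quotients contradicts the spectral gap unless `[S, P] = 0`. -/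
lemma lie_eq_zero_of_gap {n : ℕ} {S P W Λ : Matrix (Fin n) (Fin n) ℂ}
    (hΛ : Λ ∈ Matrix.unitaryGroup (Fin n) ℂ) {p w : Fin n → ℝ}
    (hp : Λᴴ * P * Λ = Matrix.diagonal fun j => Complex.I * (p j : ℂ))
    (hw : Λᴴ * W * Λ = Matrix.diagonal fun j => Complex.I * (w j : ℂ))
    (hratio : ∀ j k : Fin n, j < k → p k ≠ p j → -6 < (w k - w j) / (p k - p j))
    (hgap : 6 * ((⁅S, P⁆ᴴ * ⁅S, P⁆).trace).re ≤ -((⁅S, P⁆ᴴ * ⁅S, W⁆).trace).re) :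
    ⁅S, P⁆ = 0 := by
  have hΛ1 : Λ * Λᴴ = 1 := Matrix.mem_unitaryGroup_iff.1 hΛ
  set Y := Λᴴ * S * Λ with hY
  have hSP : Λᴴ * ⁅S, P⁆ * Λ = ⁅Y, Matrix.diagonal fun j => Complex.I * (p j : ℂ)⁆ := by
    rw [lie_conj hΛ1, hp]
  have hSW : Λᴴ * ⁅S, W⁆ * Λ = ⁅Y, Matrix.diagonal fun j => Complex.I * (w j : ℂ)⁆ := by
    rw [lie_conj hΛ1, hw]
  have hratio' : ∀ j k : Fin n, p k ≠ p j →
      0 < (p k - p j) * (w k - w j) + 6 * (p k - p j) ^ 2 := by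
    have aux : ∀ a b : ℝ, a ≠ 0 → -6 < b / a → 0 < a * b + 6 * a ^ 2 := by
      intro a b ha h
      have h2 : 0 < a ^ 2 := by positivity
      have : a * b = a ^ 2 * (b / a) := by field_simp
      rw [this]; nlinarith
    intro j k hne
    rcases lt_trichotomy j k with h | h | h
    · exact aux _ _ (sub_ne_zero.2 hne) (hratio j k h hne)
    · exact absurd (by rw [h]) hne
    · have := aux _ _ (sub_ne_zero.2 hne.symm) (hratio k j h hne.symm)
      nlinarith
  have hnorm : ∀ d e : Fin n → ℝ, ∀ j k,
      (star (Complex.I * ((d k - d j : ℝ) : ℂ) * Y j k) *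
        (Complex.I * ((e k - e j : ℝ) : ℂ) * Y j k)).re
        = (d k - d j) * (e k - e j) * Complex.normSq (Y j k) := by
    intro d e j k
    have : star (Complex.I * ((d k - d j : ℝ) : ℂ) * Y j k) *
        (Complex.I * ((e k - e j : ℝ) : ℂ) * Y j k)
        = (((d k - d j) * (e k - e j) * Complex.normSq (Y j k) : ℝ) : ℂ) := by
      rw [Complex.star_def, map_mul, map_mul, Complex.conj_I, Complex.conj_ofReal,
        Complex.ofReal_mul, Complex.ofReal_mul, Complex.normSq_eq_conj_mul_self]
      linear_combination (-((d k - d j : ℝ) : ℂ) * ((e k - e j : ℝ) : ℂ) *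
        ((starRingEnd ℂ) (Y j k) * Y j k)) * Complex.I_sq
    rw [this, Complex.ofReal_re]
  rw [← trace_conj hΛ1, ← trace_conj hΛ1 ⁅S, P⁆ ⁅S, W⁆, hSP, hSW, trace_conjTranspose_mul,
    trace_conjTranspose_mul] at hgap
  simp only [lie_diagonal_apply, Complex.re_sum, hnorm] at hgap
  have hnn : ∀ j k, 0 ≤ ((p k - p j) * (w k - w j) + 6 * (p k - p j) ^ 2) *
      Complex.normSq (Y j k) := by
    intro j k
    refine mul_nonneg ?_ (Complex.normSq_nonneg _)
    by_cases h : p k = p j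
    · simp [h]
    · exact (hratio' j k h).le
  have hle : ∑ j, ∑ k, ((p k - p j) * (w k - w j) + 6 * (p k - p j) ^ 2) *
      Complex.normSq (Y j k) ≤ 0 := by
    have : ∑ j, ∑ k, ((p k - p j) * (w k - w j) + 6 * (p k - p j) ^ 2) * Complex.normSq (Y j k)
        = ∑ j, ∑ k, (p k - p j) * (w k - w j) * Complex.normSq (Y j k)
        + 6 * ∑ j, ∑ k, (p k - p j) * (p k - p j) * Complex.normSq (Y j k) := by
      simp only [Finset.mul_sum, ← Finset.sum_add_distrib]
      refine Finset.sum_congr rfl fun j _ => Finset.sum_congr rfl fun k _ => ?_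
      ring
    rw [this]; linarith
  have hzero : ∀ j k, ((p k - p j) * (w k - w j) + 6 * (p k - p j) ^ 2) *
      Complex.normSq (Y j k) = 0 := by
    have h0 := le_antisymm hle (Finset.sum_nonneg fun j _ => Finset.sum_nonneg fun k _ => hnn j k)
    rw [Finset.sum_eq_zero_iff_of_nonneg fun j _ => Finset.sum_nonneg fun k _ => hnn j k] at h0
    intro j k
    exact (Finset.sum_eq_zero_iff_of_nonneg fun k _ => hnn j k).1 (h0 j (Finset.mem_univ _)) k
      (Finset.mem_univ _)
  have hB : Λᴴ * ⁅S, P⁆ * Λ = 0 := by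
    rw [hSP]
    ext j k
    rw [lie_diagonal_apply, Matrix.zero_apply]
    by_cases h : p k = p j
    · simp [h]
    · have := (mul_eq_zero.1 (hzero j k)).resolve_left (hratio' j k h).ne'
      rw [Complex.normSq_eq_zero.1 this, mul_zero]
  calc ⁅S, P⁆ = (Λ * Λᴴ) * ⁅S, P⁆ * (Λ * Λᴴ) := by rw [hΛ1, one_mul, mul_one]
    _ = Λ * (Λᴴ * ⁅S, P⁆ * Λ) * Λᴴ := by simp only [mul_assoc]
    _ = 0 := by rw [hB, mul_zero, zero_mul]

lemma casimirOp_lie_spinVec {n : ℕ} (v : Fin 3 → ℝ) (P : Matrix (Fin n) (Fin n) ℂ) :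
    casimirOp n ⁅spinVec n v, P⁆ = ⁅spinVec n v, casimirOp n P⁆ := by
  have h : ∀ α, casimirOp n ⁅spin n α, P⁆ = ⁅spin n α, casimirOp n P⁆ := fun α =>
    LinearMap.congr_fun (casimirOp_comm_spin n α).eq P
  rw [spinVec_eq]
  simp only [add_lie, smul_lie, map_add, map_smul, h]

/-- A steady state satisfying the bound on difference quotients is invariant under the rotations
about some axis. -/
lemma exists_lie_spinVec_eq_zero {n : ℕ} (hn : 2 ≤ n)
    {W P Λ : Matrix (Fin n) (Fin n) ℂ} (hP : Pᴴ = -P) (hlap : W = laplacian n P)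
    (hΛ : Λ ∈ Matrix.unitaryGroup (Fin n) ℂ) {p w : Fin n → ℝ}
    (hp : Λᴴ * P * Λ = Matrix.diagonal fun j => Complex.I * (p j : ℂ))
    (hw : Λᴴ * W * Λ = Matrix.diagonal fun j => Complex.I * (w j : ℂ))
    (hratio : ∀ j k : Fin n, j < k → p k ≠ p j → -6 < (w k - w j) / (p k - p j)) :
    ∃ v : Fin 3 → ℝ, v ≠ 0 ∧ ⁅spinVec n v, W⁆ = 0 := by
  obtain ⟨v, hv, hmem⟩ := exists_axis hP
  have hcas : casimirOp n ⁅spinVec n v, P⁆ = -⁅spinVec n v, W⁆ := by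
    rw [casimirOp_lie_spinVec, hlap, laplacian_eq_neg_casimirOp hn, lie_neg, neg_neg]
  have hgap := six_mul_le_trace_casimirOp hn hmem
  rw [hcas, mul_neg, Matrix.trace_neg, Complex.neg_re] at hgap
  have h0 := lie_eq_zero_of_gap hΛ hp hw hratio hgap
  rw [h0, map_zero, zero_eq_neg] at hcas
  exact ⟨v, hv, hcas⟩

/-! ### Rotations and the spin representation -/

/-- The left-hand side is constant in `t`, since its derivative vanishes. -/
lemma conj_exp_smul_eq {A B : Type*} [NormedRing A] [NormedAlgebra ℝ A] [CompleteSpace A]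
    [NormedRing B] [NormedAlgebra ℝ B] [CompleteSpace B] (Φ : A →L[ℝ] B) (K : A) (a : B)
    (h : ∀ Q, a * Φ Q - Φ Q * a = Φ (K * Q)) (t : ℝ) :
    NormedSpace.exp (t • -a) * Φ (NormedSpace.exp (t • K)) * NormedSpace.exp (t • a) = Φ 1 := by
  have hd : ∀ s : ℝ, HasDerivAt (fun s : ℝ => NormedSpace.exp (s • -a) *
      Φ (NormedSpace.exp (s • K)) * NormedSpace.exp (s • a)) 0 s := by
    intro s
    have h1 := hasDerivAt_exp_smul_const (𝕂 := ℝ) (-a) s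
    have h2 := Φ.hasFDerivAt.comp_hasDerivAt s (hasDerivAt_exp_smul_const' (𝕂 := ℝ) K s)
    have h3 := hasDerivAt_exp_smul_const' (𝕂 := ℝ) a s
    refine ((h1.mul h2).mul h3).congr_deriv ?_
    simp only [Pi.mul_apply, Function.comp_apply]
    rw [← h]
    noncomm_ring
  have := is_const_of_deriv_eq_zero (fun s => (hd s).differentiableAt) (fun s => (hd s).deriv) t 0
  simpa using this

/-- Conjugation by `exp a` corresponds to multiplication by `exp K` under a linear map that
intertwines the commutator with `a` and multiplication by `K`. -/
lemma exp_mul_mul_exp_neg {A B : Type*} [NormedRing A] [NormedAlgebra ℝ A] [CompleteSpace A]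
    [NormedRing B] [NormedAlgebra ℝ B] [CompleteSpace B] (Φ : A →L[ℝ] B) (K : A) (a : B)
    (h : ∀ Q, a * Φ Q - Φ Q * a = Φ (K * Q)) :
    NormedSpace.exp a * Φ 1 * NormedSpace.exp (-a) = Φ (NormedSpace.exp K) := by
  let : NormedAlgebra ℚ B := NormedAlgebra.restrictScalars ℚ ℝ B
  have h1 := conj_exp_smul_eq Φ K a h 1
  have h2 : NormedSpace.exp a * NormedSpace.exp (-a) = 1 := by
    rw [← NormedSpace.exp_add_of_commute (Commute.refl a).neg_right, add_neg_cancel,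
      NormedSpace.exp_zero]
  simp only [one_smul] at h1
  rw [← h1]
  calc _ = (NormedSpace.exp a * NormedSpace.exp (-a)) * Φ (NormedSpace.exp K) *
        (NormedSpace.exp a * NormedSpace.exp (-a)) := by simp only [mul_assoc]
    _ = _ := by rw [h2, one_mul, mul_one]

/-- The Rodrigues formula for a half-turn. -/
lemma exp_pi_smul {A : Type*} [NormedRing A] [NormedAlgebra ℝ A] [CompleteSpace A] {K : A}
    (hK : K * K * K = -K) : NormedSpace.exp (Real.pi • K) = 1 + (2 : ℝ) • (K * K) := by
  let : NormedAlgebra ℚ A := NormedAlgebra.restrictScalars ℚ ℝ A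
  have hd : ∀ s : ℝ, HasDerivAt (fun s : ℝ => NormedSpace.exp (s • -K) *
      (1 + Real.sin s • K + (1 - Real.cos s) • (K * K))) 0 s := by
    intro s
    have h1 := hasDerivAt_exp_smul_const (𝕂 := ℝ) (-K) s
    have h2 := (((Real.hasDerivAt_sin s).smul_const K).const_add (1 : A)).add
      (((Real.hasDerivAt_cos s).const_sub 1).smul_const (K * K))
    refine (h1.mul h2).congr_deriv ?_
    rw [mul_assoc, ← mul_add]
    have : -K * (1 + Real.sin s • K + (1 - Real.cos s) • (K * K)) +
        (Real.cos s • K + (- -Real.sin s) • (K * K)) = 0 := by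
      simp only [mul_add, mul_one, neg_mul, mul_smul_comm, ← mul_assoc, hK]
      module
    simp only [Pi.add_apply]
    rw [this, mul_zero]
  have h1 := is_const_of_deriv_eq_zero (fun s => (hd s).differentiableAt)
    (fun s => (hd s).deriv) Real.pi 0
  simp only [Real.sin_pi, Real.cos_pi, zero_smul, Real.sin_zero, Real.cos_zero, sub_self, add_zero,
    neg_zero, NormedSpace.exp_zero, mul_one, smul_neg] at h1
  have h2 : NormedSpace.exp (Real.pi • K) * NormedSpace.exp (-(Real.pi • K)) = 1 := by
    rw [← NormedSpace.exp_add_of_commute (Commute.refl _).neg_right, add_neg_cancel,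
      NormedSpace.exp_zero]
  calc NormedSpace.exp (Real.pi • K)
      = NormedSpace.exp (Real.pi • K) * (NormedSpace.exp (-(Real.pi • K)) *
        (1 + (1 - -1 : ℝ) • (K * K))) := by rw [h1, mul_one]
    _ = _ := by rw [← mul_assoc, h2, one_mul]; norm_num

lemma transpose_so3OfVec (ρ : Fin 3 → ℝ) : (so3OfVec ρ)ᵀ = -so3OfVec ρ := by
  ext i j
  fin_cases i <;> fin_cases j <;> simp [so3OfVec]

lemma so3OfVec_smul (c : ℝ) (ρ : Fin 3 → ℝ) : so3OfVec (c • ρ) = c • so3OfVec ρ := by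
  ext i j
  fin_cases i <;> fin_cases j <;> simp [so3OfVec]

lemma exp_so3OfVec_mem (ρ : Fin 3 → ℝ) :
    NormedSpace.exp (so3OfVec ρ) ∈ Matrix.specialOrthogonalGroup (Fin 3) ℝ := by
  have hmem : ∀ ρ, NormedSpace.exp (so3OfVec ρ) ∈ Matrix.orthogonalGroup (Fin 3) ℝ := by
    intro ρ
    rw [Matrix.mem_orthogonalGroup_iff, ← Matrix.exp_transpose, transpose_so3OfVec,
      ← Matrix.exp_add_of_commute _ _ (Commute.refl (so3OfVec ρ)).neg_right, add_neg_cancel,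
      NormedSpace.exp_zero]
  refine Matrix.mem_specialOrthogonalGroup_iff.2 ⟨hmem ρ, ?_⟩
  -- A rotation is the square of the rotation by half the angle.
  have h1 : so3OfVec ρ = 2 • so3OfVec ((1 / 2 : ℝ) • ρ) := by
    rw [so3OfVec_smul]; module
  have h2 := congrArg Matrix.det ((Matrix.mem_orthogonalGroup_iff _ _).1 (hmem ((1 / 2 : ℝ) • ρ)))
  rw [Matrix.det_mul, Matrix.det_transpose, Matrix.det_one] at h2
  rw [h1, Matrix.exp_nsmul, Matrix.det_pow, sq]
  simpa using h2

/-- `rotLog` is a logarithm of every rotation that has one of length at most `π`. It may differ from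
the given `ρ`, but only the rotation itself matters for its action on the spin matrices. -/
lemma exp_so3OfVec_rotLog {ρ : Fin 3 → ℝ} (hρ : ∑ α, ρ α ^ 2 ≤ Real.pi ^ 2) :
    NormedSpace.exp (so3OfVec (rotLog ⟨_, exp_so3OfVec_mem ρ⟩)) = NormedSpace.exp (so3OfVec ρ) := by
  have h : ∃ ρ' : Fin 3 → ℝ, ∑ α, ρ' α ^ 2 ≤ Real.pi ^ 2 ∧
      NormedSpace.exp (so3OfVec ρ') = NormedSpace.exp (so3OfVec ρ) := ⟨ρ, hρ, rfl⟩
  rw [rotLog, dif_pos h]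
  exact h.choose_spec.2

open scoped Matrix.Norms.Operator in
lemma exp_so3OfVec_pi {m : Fin 3 → ℝ} (hm : m 0 ^ 2 + m 1 ^ 2 + m 2 ^ 2 = 1) :
    NormedSpace.exp (so3OfVec (Real.pi • m)) = 1 + (2 : ℝ) • (so3OfVec m * so3OfVec m) := by
  rw [so3OfVec_smul]
  refine exp_pi_smul ?_
  have h : so3OfVec m * so3OfVec m * so3OfVec m
      = -((m 0 ^ 2 + m 1 ^ 2 + m 2 ^ 2) • so3OfVec m) := by
    ext i j
    fin_cases i <;> fin_cases j <;>
      simp [so3OfVec, Matrix.mul_apply, Fin.sum_univ_three] <;> ring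
  rw [h, hm, one_smul]

/-- Every vector can be rotated to the third axis: unless it already points along the negative
axis, by a half-turn about the bisector of the vector and the axis. -/
lemma exists_rotation_to_axis (v : Fin 3 → ℝ) :
    ∃ ρ : Fin 3 → ℝ, ∑ α, ρ α ^ 2 ≤ Real.pi ^ 2 ∧
      (NormedSpace.exp (so3OfVec ρ) *ᵥ v) 0 = 0 ∧ (NormedSpace.exp (so3OfVec ρ) *ᵥ v) 1 = 0 := by
  -- The bisector is `v + r e₃` with `r = |v|`, of length `s`; it vanishes if `v = -r e₃`.
  set r := Real.sqrt (v 0 ^ 2 + v 1 ^ 2 + v 2 ^ 2) with hr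
  have hr2 : r ^ 2 = v 0 ^ 2 + v 1 ^ 2 + v 2 ^ 2 := Real.sq_sqrt (by positivity)
  set s := Real.sqrt (v 0 ^ 2 + v 1 ^ 2 + (v 2 + r) ^ 2) with hs
  have hs2 : s ^ 2 = v 0 ^ 2 + v 1 ^ 2 + (v 2 + r) ^ 2 := Real.sq_sqrt (by positivity)
  by_cases h0 : s = 0
  · have hv0 : v 0 = 0 := by
      rw [h0] at hs2; nlinarith [sq_nonneg (v 0), sq_nonneg (v 1), sq_nonneg (v 2 + r)]
    have hv1 : v 1 = 0 := by
      rw [h0] at hs2; nlinarith [sq_nonneg (v 0), sq_nonneg (v 1), sq_nonneg (v 2 + r)]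
    have hz : so3OfVec 0 = 0 := by
      have := so3OfVec_smul 0 0
      rwa [zero_smul, zero_smul] at this
    refine ⟨0, by simpa using sq_nonneg Real.pi, ?_⟩
    rw [hz, NormedSpace.exp_zero, Matrix.one_mulVec]
    exact ⟨hv0, hv1⟩
  · have hsne : s ^ 2 ≠ 0 := pow_ne_zero 2 h0
    set m : Fin 3 → ℝ := ![v 0 / s, v 1 / s, (v 2 + r) / s] with hm
    have hm1 : m 0 ^ 2 + m 1 ^ 2 + m 2 ^ 2 = 1 := by
      simp only [hm, Matrix.cons_val]
      field_simp
      rw [hs2]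
    refine ⟨Real.pi • m, ?_, ?_⟩
    · simp only [Pi.smul_apply, smul_eq_mul, Fin.sum_univ_three, mul_pow, ← mul_add, hm1, mul_one,
        le_refl]
    · rw [exp_so3OfVec_pi hm1, Matrix.add_mulVec, Matrix.smul_mulVec, Matrix.one_mulVec]
      simp only [Matrix.mulVec, dotProduct, Matrix.mul_apply, so3OfVec, Fin.sum_univ_three,
        Matrix.of_apply, Matrix.cons_val, hm, Pi.add_apply, Pi.smul_apply, smul_eq_mul]
      constructor
      · field_simp
        rw [hs2]
        linear_combination (-v 0) * hr2
      · field_simp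
        rw [hs2]
        linear_combination (-v 1) * hr2

lemma spinVec_add (n : ℕ) (u v : Fin 3 → ℝ) : spinVec n (u + v) = spinVec n u + spinVec n v := by
  simp [spinVec, add_smul, Finset.sum_add_distrib]

lemma spinVec_smul (n : ℕ) (c : ℝ) (v : Fin 3 → ℝ) : spinVec n (c • v) = c • spinVec n v := by
  simp only [spinVec, Finset.smul_sum, Pi.smul_apply, smul_eq_mul, Complex.ofReal_mul, mul_smul,
    Complex.coe_smul]

lemma spinVec_mulVec_lie (n : ℕ) (ρ u : Fin 3 → ℝ) :
    ⁅-Complex.I • spinVec n ρ, spinVec n u⁆ = spinVec n (so3OfVec ρ *ᵥ u) := by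
  have h01 := lie_spin_zero_one n
  have h12 := lie_spin_one_two n
  have h20 := lie_spin_two_zero n
  have h10 : ⁅spin n 1, spin n 0⁆ = -(Complex.I • spin n 2) := by rw [← lie_skew, h01]
  have h21 : ⁅spin n 2, spin n 1⁆ = -(Complex.I • spin n 0) := by rw [← lie_skew, h12]
  have h02 : ⁅spin n 0, spin n 2⁆ = -(Complex.I • spin n 1) := by rw [← lie_skew, h20]
  rw [spinVec_eq, spinVec_eq, spinVec_eq]
  simp only [smul_lie, lie_add, lie_smul, add_lie, lie_self, h01, h12, h20, h10, h21, h02,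
    Matrix.mulVec, dotProduct, so3OfVec, Fin.sum_univ_three, Matrix.of_apply, Matrix.cons_val]
  match_scalars <;> ring_nf <;> simp only [Complex.I_sq] <;> ring

open scoped Matrix.Norms.Operator in
lemma exp_conj_spinVec (n : ℕ) (ρ u : Fin 3 → ℝ) :
    NormedSpace.exp (-Complex.I • spinVec n ρ) * spinVec n u *
      NormedSpace.exp (-(-Complex.I • spinVec n ρ))
      = spinVec n (NormedSpace.exp (so3OfVec ρ) *ᵥ u) := by
  let Φ : Matrix (Fin 3) (Fin 3) ℝ →ₗ[ℝ] Matrix (Fin n) (Fin n) ℂ :=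
    { toFun := fun Q => spinVec n (Q *ᵥ u)
      map_add' := fun Q Q' => by rw [Matrix.add_mulVec, spinVec_add]
      map_smul' := fun c Q => by rw [Matrix.smul_mulVec, spinVec_smul]; rfl }
  have := exp_mul_mul_exp_neg Φ.toContinuousLinearMap (so3OfVec ρ) (-Complex.I • spinVec n ρ)
    (fun Q => by
      change ⁅-Complex.I • spinVec n ρ, spinVec n (Q *ᵥ u)⁆ = spinVec n ((so3OfVec ρ * Q) *ᵥ u)
      rw [spinVec_mulVec_lie, Matrix.mulVec_mulVec])
  change _ * spinVec n (1 *ᵥ u) * _ = spinVec n (_ *ᵥ u) at this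
  rwa [Matrix.one_mulVec] at this

lemma conjTranspose_spinVec (n : ℕ) (v : Fin 3 → ℝ) : (spinVec n v)ᴴ = spinVec n v := by
  rw [spinVec, Matrix.conjTranspose_sum]
  refine Finset.sum_congr rfl fun α _ => ?_
  rw [Matrix.conjTranspose_smul, conjTranspose_spin, Complex.star_def, Complex.conj_ofReal]

lemma rotUnitary_eq {n : ℕ} (hn : 2 ≤ n) (R : Matrix.specialOrthogonalGroup (Fin 3) ℝ) :
    rotUnitary n R = NormedSpace.exp (-Complex.I • spinVec n (rotLog R)) := by
  have h0 := hbar_ne_zero hn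
  rw [rotUnitary, spinVec, Finset.smul_sum, Finset.smul_sum]
  congr 1
  refine Finset.sum_congr rfl fun α _ => ?_
  rw [X, smul_smul, smul_smul, smul_smul]
  congr 1
  field_simp

lemma conjTranspose_rotUnitary {n : ℕ} (hn : 2 ≤ n) (R : Matrix.specialOrthogonalGroup (Fin 3) ℝ) :
    (rotUnitary n R)ᴴ = NormedSpace.exp (-(-Complex.I • spinVec n (rotLog R))) := by
  rw [rotUnitary_eq hn, ← Matrix.exp_conjTranspose, Matrix.conjTranspose_smul,
    conjTranspose_spinVec]
  simp

lemma conjTranspose_rotUnitary_mul_self {n : ℕ} (hn : 2 ≤ n)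
    (R : Matrix.specialOrthogonalGroup (Fin 3) ℝ) : (rotUnitary n R)ᴴ * rotUnitary n R = 1 := by
  rw [conjTranspose_rotUnitary hn, rotUnitary_eq hn,
    ← Matrix.exp_add_of_commute _ _ (Commute.refl (-Complex.I • spinVec n (rotLog R))).neg_left,
    neg_add_cancel, NormedSpace.exp_zero]

lemma rotate_lie {n : ℕ} (hn : 2 ≤ n) (R : Matrix.specialOrthogonalGroup (Fin 3) ℝ)
    (A B : Matrix (Fin n) (Fin n) ℂ) : rotate n R ⁅A, B⁆ = ⁅rotate n R A, rotate n R B⁆ := by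
  have h : ((rotUnitary n R)ᴴ) * ((rotUnitary n R)ᴴ)ᴴ = 1 := by
    rw [Matrix.conjTranspose_conjTranspose, conjTranspose_rotUnitary_mul_self hn]
  simpa only [rotate, Matrix.conjTranspose_conjTranspose] using lie_conj h A B

lemma rotate_spinVec {n : ℕ} (hn : 2 ≤ n) (R : Matrix.specialOrthogonalGroup (Fin 3) ℝ)
    (v : Fin 3 → ℝ) :
    rotate n R (spinVec n v) = spinVec n (NormedSpace.exp (so3OfVec (rotLog R)) *ᵥ v) := by
  rw [rotate, conjTranspose_rotUnitary hn, rotUnitary_eq hn, exp_conj_spinVec]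

lemma isDiag_of_lie_spin_two {n : ℕ} {Z : Matrix (Fin n) (Fin n) ℂ} (h : ⁅spin n 2, Z⁆ = 0) :
    Z.IsDiag := by
  intro j k hjk
  have h1 := congrFun (congrFun h j) k
  rw [lie_spin_two_apply, Matrix.zero_apply] at h1
  refine (mul_eq_zero.1 h1).resolve_left (sub_ne_zero.2 fun h2 => hjk (Fin.ext ?_))
  exact_mod_cast h2.symm

/-- A matrix commuting with a spin component can be rotated to a diagonal matrix. -/
lemma exists_rotate_isDiag {n : ℕ} (hn : 2 ≤ n) {W : Matrix (Fin n) (Fin n) ℂ} {v : Fin 3 → ℝ}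
    (hv : v ≠ 0) (h : ⁅spinVec n v, W⁆ = 0) :
    ∃ R : Matrix.specialOrthogonalGroup (Fin 3) ℝ, (rotate n R W).IsDiag := by
  obtain ⟨ρ, hρ, h0, h1⟩ := exists_rotation_to_axis v
  refine ⟨⟨_, exp_so3OfVec_mem ρ⟩, isDiag_of_lie_spin_two ?_⟩
  set u := NormedSpace.exp (so3OfVec ρ) *ᵥ v with hu
  have hu2 : u 2 ≠ 0 := by
    intro h2
    have hu0 : u = 0 := by ext i; fin_cases i <;> assumption
    refine hv (Matrix.mulVec_injective_of_isUnit (Matrix.isUnit_exp (so3OfVec ρ)) ?_)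
    simpa [← hu] using hu0
  have key := rotate_lie hn ⟨_, exp_so3OfVec_mem ρ⟩ (spinVec n v) W
  rw [h, rotate_spinVec hn, exp_so3OfVec_rotLog hρ, ← hu, spinVec_eq, h0, h1] at key
  have hz : rotate n ⟨_, exp_so3OfVec_mem ρ⟩ (0 : Matrix (Fin n) (Fin n) ℂ) = 0 := by
    simp [rotate]
  rw [hz] at key
  simp only [Complex.ofReal_zero, zero_smul, zero_add, smul_lie] at key
  exact (smul_eq_zero.1 key.symm).resolve_left (by exact_mod_cast hu2)

end Zeitlin

theorem proposition4p1 (n : ℕ) (hn : 2 ≤ n)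
    (W₀ P₀ : Matrix (Fin n) (Fin n) ℂ) (hsteady : Zeitlin.IsSteadyState n W₀ P₀)
    (Λ : Matrix (Fin n) (Fin n) ℂ) (hΛ : Λ ∈ Matrix.unitaryGroup (Fin n) ℂ)
    (p w : Fin n → ℝ)
    (hp : Λᴴ * P₀ * Λ = Matrix.diagonal fun j => Complex.I * (p j : ℂ))
    (hw : Λᴴ * W₀ * Λ = Matrix.diagonal fun j => Complex.I * (w j : ℂ))
    (hratio : ∀ j k : Fin n, j < k → p k ≠ p j → -6 < (w k - w j) / (p k - p j)) :
    ∃ R : Matrix.specialOrthogonalGroup (Fin 3) ℝ, (Zeitlin.rotate n R W₀).IsDiag := by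
  obtain ⟨v, hv, hlie⟩ := Zeitlin.exists_lie_spinVec_eq_zero hn hsteady.stream_mem.1
    hsteady.laplacian_eq hΛ hp hw hratio
  exact Zeitlin.exists_rotate_isDiag hn hv hlie
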